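/- Let $a\in\mathbb{R}^3\setminus\{0\}$. A translating soliton with velocity $a$ is a surface, given by a $C^2$ immersion $f:\Sigma\to\mathbb{R}^3$ of a $2$-dimensional $C^2$ manifold $\Sigma$ without boundary, such that $$2H=\langle N,a\rangle$$ at every point of $\Sigma$, where $N$ is a unit vector normal to the surface at that point and $H$ is the mean curvature with respect to $N$, that is, the average of the principal curvatures (the condition does not depend on the choice between $N$ and $-N$, so $\Sigma$ need not be oriented). The principal curvatures are the eigenvalues of the second fundamental form $\langle \partial_i\partial_j f,N\rangle$ relative to the first fundamental form $\langle\partial_i f,\partial_j f\rangle$. There are no closed translating solitons: if $\Sigma$ is compact, non-empty and without boundary, then no $C^2$ immersion $f:\Sigma\to\mathbb{R}^3$ is a translating soliton with velocity $a$. -/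

import Mathlib

open scoped Manifold ContDiff

noncomputable section

/-- The Euclidean plane. -/
abbrev Plane : Type := EuclideanSpace ℝ (Fin 2)

/-- Euclidean three-space. -/
abbrev Space : Type := EuclideanSpace ℝ (Fin 3)

/-- The partial derivative `∂ᵢ X` of a map `X` from the plane to three-space. -/
def partialD (i : Fin 2) (X : Plane → Space) (u : Plane) : Space :=
  fderiv ℝ X u (EuclideanSpace.single i 1)

/-- The matrix `⟨∂ᵢ X, ∂ⱼ X⟩` of the first fundamental form of the parametrization `X`. -/
def firstFundamentalForm (X : Plane → Space) (u : Plane) : Matrix (Fin 2) (Fin 2) ℝ :=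
  Matrix.of fun i j => inner ℝ (partialD i X u) (partialD j X u)

/-- The matrix `⟨∂ᵢ ∂ⱼ X, ν⟩` of the second fundamental form of the parametrization `X`
with respect to the unit normal vector `ν`. -/
def secondFundamentalForm (X : Plane → Space) (u : Plane) (ν : Space) :
    Matrix (Fin 2) (Fin 2) ℝ :=
  Matrix.of fun i j => inner ℝ (partialD i (partialD j X) u) ν

section Surfaces

variable {M : Type*} [TopologicalSpace M] [ChartedSpace Plane M]

/-- `f : M → ℝ³` is a `C²` immersion: it is `C²` and its differential is injective everywhere. -/
def IsImmersedSurface (f : M → Space) : Prop :=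
  ContMDiff (𝓡 2) 𝓘(ℝ, Space) 2 f ∧
    ∀ p : M, Function.Injective (mfderiv (𝓡 2) 𝓘(ℝ, Space) f p)

/-- `ν` is a unit vector orthogonal to the tangent plane `df_p(T_p M)` of the surface at `p`. -/
def IsUnitNormalAt (f : M → Space) (p : M) (ν : Space) : Prop :=
  ‖ν‖ = 1 ∧
    ∀ v : TangentSpace (𝓡 2) p, @inner ℝ Space _ (mfderiv (𝓡 2) 𝓘(ℝ, Space) f p v) ν = 0

/-- The local parametrization of the surface `f : M → ℝ³` given by the preferred chart at `p`. -/
def localParametrization (f : M → Space) (p : M) : Plane → Space :=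
  f ∘ (extChartAt (𝓡 2) p).symm

/-- The mean curvature of the immersed surface `f` at `p` with respect to the unit normal `ν`:
the average of the principal curvatures, that is, half the trace of the shape operator, whose
matrix in the coordinate basis is `I⁻¹ * II`. For an immersion the value does not depend
on the chart, and it changes sign with `ν`. -/
def meanCurvature (f : M → Space) (p : M) (ν : Space) : ℝ :=
  (1 / 2) * Matrix.trace
    ((firstFundamentalForm (localParametrization f p) (extChartAt (𝓡 2) p p))⁻¹ *
      secondFundamentalForm (localParametrization f p) (extChartAt (𝓡 2) p p) ν)

/-- The immersed surface `f : M → ℝ³` is a translating soliton with velocity `a`: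
`2 H = ⟨N, a⟩` at every point. Both sides change sign with `N`, so the condition for one unit
normal at a point is the same as for the other, and no orientation of `M` has to be chosen. -/
def IsTranslatingSoliton (a : Space) (f : M → Space) : Prop :=
  IsImmersedSurface f ∧
    ∀ (p : M) (ν : Space), IsUnitNormalAt f p ν → 2 * meanCurvature f p ν = inner ℝ ν a

end Surfaces

end

/-! By compactness the height in the direction ν = a/‖a‖ attains a maximum. There ν is normal to the
surface, and the second fundamental form with respect to ν is the Hessian of the height in a chart,
hence negative semidefinite. Tracing against the inverse of the first fundamental form gives 2H ≤ 0,
whereas the soliton equation gives 2H = ⟨ν, a⟩ = ‖a‖ > 0. -/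

/-- The second derivative of a `C²` function is negative semidefinite at a local maximum. -/
theorem IsLocalMax.fderiv_fderiv_apply_self_nonpos {E : Type*} [NormedAddCommGroup E]
    [NormedSpace ℝ E] {g : E → ℝ} {x : E} (hmax : IsLocalMax g x) (hg : ContDiffAt ℝ 2 g x)
    (v : E) : fderiv ℝ (fderiv ℝ g) x v v ≤ 0 := by
  by_contra! hpos
  have hline : ∀ t : ℝ, HasDerivAt (fun t : ℝ => x + t • v) v t := fun t => by
    simpa using ((hasDerivAt_id t).smul_const v).const_add x
  have hcont : Filter.Tendsto (fun t : ℝ => x + t • v) (nhds 0) (nhds x) := by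
    simpa using (hline 0).continuousAt.tendsto
  have hdiff : ∀ᶠ y in nhds x, DifferentiableAt ℝ g y :=
    (hg.eventually (by simp)).mono fun y hy => hy.differentiableAt (by simp)
  have hderiv : deriv (fun t : ℝ => g (x + t • v)) =ᶠ[nhds 0]
      fun t => fderiv ℝ g (x + t • v) v :=
    (hcont.eventually hdiff).mono fun t ht =>
      (ht.hasFDerivAt.comp_hasDerivAt t (hline t)).deriv
  have hfd : HasFDerivAt (fderiv ℝ g) (fderiv ℝ (fderiv ℝ g) x) (x + (0 : ℝ) • v) := by
    rw [zero_smul, add_zero]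
    exact ((hg.fderiv_right (m := 1) (by norm_num)).differentiableAt (by simp)).hasFDerivAt
  have hsecond : deriv (deriv fun t : ℝ => g (x + t • v)) 0 = fderiv ℝ (fderiv ℝ g) x v v := by
    rw [hderiv.deriv_eq]
    have heval : HasFDerivAt (fun y => fderiv ℝ g y v) ((fderiv ℝ (fderiv ℝ g) x).flip v)
        (x + (0 : ℝ) • v) := by
      simpa using! hfd.clm_apply (hasFDerivAt_const v (x + (0 : ℝ) • v))
    exact (heval.comp_hasDerivAt (0 : ℝ) (hline 0)).deriv
  have hlmax : IsLocalMax (fun t : ℝ => g (x + t • v)) 0 := by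
    have := hcont.eventually hmax
    simpa [IsLocalMax, IsMaxFilter] using this
  -- A positive second derivative would make 0 a local minimum as well, so `g` would be constant
  -- along the line near 0 and the second derivative would vanish.
  have hlmin : IsLocalMin (fun t : ℝ => g (x + t • v)) 0 := by
    refine isLocalMin_of_deriv_deriv_pos (hsecond ▸ hpos) hlmax.deriv_eq_zero ?_
    have : ContinuousAt g (x + (0 : ℝ) • v) := by simpa using hg.continuousAt
    exact this.comp (f := fun t : ℝ => x + t • v) (hline 0).continuousAt
  have hconst : (fun t : ℝ => g (x + t • v)) =ᶠ[nhds 0] fun _ => g (x + (0 : ℝ) • v) := by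
    filter_upwards [hlmax, hlmin] with t h₁ h₂ using le_antisymm h₁ h₂
  have hzero : deriv (deriv fun t : ℝ => g (x + t • v)) 0 = 0 := by
    rw [hconst.deriv.deriv_eq]
    simp
  linarith

open scoped MatrixOrder in
/-- The trace of the product of a positive semidefinite matrix and a matrix whose quadratic form
is nonpositive is nonpositive. -/
theorem Matrix.PosSemidef.trace_mul_nonpos {n : Type*} [Fintype n] [DecidableEq n]
    {P A : Matrix n n ℝ} (hP : P.PosSemidef) (hA : ∀ v : n → ℝ, v ⬝ᵥ A.mulVec v ≤ 0) :
    (P * A).trace ≤ 0 := by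
  -- With P = BᵀB, cyclicity turns the trace into tr(B A Bᵀ), the sum of the quadratic form of A
  -- over the rows of B.
  obtain ⟨B, rfl⟩ := CStarAlgebra.nonneg_iff_eq_star_mul_self.mp hP.nonneg
  rw [Matrix.mul_assoc, Matrix.trace_mul_comm, Matrix.trace]
  refine Finset.sum_nonpos fun i _ => ?_
  have hdiag : (B * A * star B).diag i = B i ⬝ᵥ A.mulVec (B i) := by
    simp only [Matrix.diag_apply, Matrix.mul_apply, dotProduct, Matrix.mulVec, Matrix.star_apply,
      star_trivial, Finset.sum_mul, Finset.mul_sum]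
    rw [Finset.sum_comm]
    simp only [mul_assoc]
  exact hdiag.trans_le (hA (B i))

theorem firstFundamentalForm_posSemidef (X : Plane → Space) (u : Plane) :
    (firstFundamentalForm X u).PosSemidef :=
  Matrix.posSemidef_gram ℝ fun i => partialD i X u

/-- Since ν is a fixed vector, pairing with it commutes with differentiation; this reduces curvature
to the Hessian of a scalar height. -/
theorem secondFundamentalForm_apply_eq {X : Plane → Space} {u : Plane}
    (hX : ContDiffAt ℝ 2 X u) (ν : Space) (i j : Fin 2) :
    secondFundamentalForm X u ν i j =
      fderiv ℝ (fderiv ℝ fun y => (inner ℝ ν (X y) : ℝ)) u (EuclideanSpace.single i 1)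
        (EuclideanSpace.single j 1) := by
  have hdiff : ∀ᶠ y in nhds u, DifferentiableAt ℝ X y :=
    (hX.eventually (by simp)).mono fun y hy => hy.differentiableAt (by simp)
  have hfd : DifferentiableAt ℝ (fderiv ℝ X) u :=
    (hX.fderiv_right (m := 1) (by norm_num)).differentiableAt (by simp)
  have hev : fderiv ℝ (fun y => inner ℝ ν (X y)) =ᶠ[nhds u]
      fun y => (innerSL ℝ ν).comp (fderiv ℝ X y) :=
    hdiff.mono fun y hy => ((innerSL ℝ ν).hasFDerivAt.comp y hy.hasFDerivAt).fderiv
  have hpart : HasFDerivAt (partialD j X)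
      ((fderiv ℝ (fderiv ℝ X) u).flip (EuclideanSpace.single j 1)) u := by
    simpa using! hfd.hasFDerivAt.clm_apply
      (hasFDerivAt_const (EuclideanSpace.single j (1 : ℝ)) u)
  have hcomp : HasFDerivAt (fun y => (innerSL ℝ ν).comp (fderiv ℝ X y))
      ((ContinuousLinearMap.compL ℝ Plane Space ℝ (innerSL ℝ ν)).comp
        (fderiv ℝ (fderiv ℝ X) u)) u :=
    (ContinuousLinearMap.compL ℝ Plane Space ℝ (innerSL ℝ ν)).hasFDerivAt.comp u hfd.hasFDerivAt
  rw [hev.fderiv_eq, hcomp.fderiv]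
  simp only [secondFundamentalForm, Matrix.of_apply]
  rw [partialD, hpart.fderiv, real_inner_comm]
  simp

/-- If the height in the direction `ν` has a local maximum at `u`, then the trace of the shape
operator with respect to `ν` is nonpositive there. -/
theorem IsLocalMax.trace_shapeOperator_nonpos {X : Plane → Space} {u : Plane} {ν : Space}
    (hX : ContDiffAt ℝ 2 X u) (hmax : IsLocalMax (fun y => inner ℝ ν (X y)) u) :
    ((firstFundamentalForm X u)⁻¹ * secondFundamentalForm X u ν).trace ≤ 0 := by
  -- Semidefiniteness suffices: the matrix inverse is 0 in the singular case, so injectivity of the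
  -- differential plays no role here.
  refine (firstFundamentalForm_posSemidef X u).inv.trace_mul_nonpos fun v => ?_
  have h := hmax.fderiv_fderiv_apply_self_nonpos (contDiffAt_const.inner ℝ hX)
    (∑ i, v i • EuclideanSpace.single i (1 : ℝ))
  convert h using 1
  simp only [dotProduct, Matrix.mulVec, secondFundamentalForm_apply_eq hX, Fin.sum_univ_two, map_add,
    map_smul, add_apply, smul_apply, smul_eq_mul]
  ring

section Surfaces

variable {M : Type*} [TopologicalSpace M] [ChartedSpace Plane M]

theorem IsImmersedSurface.contDiffAt_localParametrization {f : M → Space}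
    (hf : IsImmersedSurface f) (p : M) :
    ContDiffAt ℝ 2 (localParametrization f p) (extChartAt (𝓡 2) p p) := by
  have h := (contMDiffAt_iff.mp (hf.1 p)).2
  simpa [contDiffWithinAt_univ] using! h

theorem IsImmersedSurface.mfderiv_eq {f : M → Space} (hf : IsImmersedSurface f) (p : M) :
    mfderiv (𝓡 2) 𝓘(ℝ, Space) f p =
      fderiv ℝ (localParametrization f p) (extChartAt (𝓡 2) p p) := by
  rw [((hf.1 p).mdifferentiableAt (by simp)).mfderiv]
  simp only [modelWithCornersSelf_coe, Set.range_id, fderivWithin_univ]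
  rfl

/-- At a maximum of the height in the unit direction `ν`, the vector `ν` is normal to the surface
and the mean curvature with respect to `ν` is nonpositive. -/
theorem IsImmersedSurface.isUnitNormalAt_and_meanCurvature_nonpos {f : M → Space}
    (hf : IsImmersedSurface f) {ν : Space} (hν : ‖ν‖ = 1) {p : M}
    (hp : ∀ q, inner ℝ ν (f q) ≤ inner ℝ ν (f p)) :
    IsUnitNormalAt f p ν ∧ meanCurvature f p ν ≤ 0 := by
  have hX := hf.contDiffAt_localParametrization p
  have hmax : IsLocalMax (fun y => inner ℝ ν (localParametrization f p y))
      -- The maximum is global on `M`, so the inequality holds for every `y`, even outside the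
      -- chart's target.
      (extChartAt (𝓡 2) p p) := .of_forall fun y => by
    simpa only [localParametrization, Function.comp_apply, extChartAt_to_inv] using! hp _
  refine ⟨⟨hν, fun v => ?_⟩, ?_⟩
  · rw [hf.mfderiv_eq]
    have h := hmax.hasFDerivAt_eq_zero
      ((innerSL ℝ ν).hasFDerivAt.comp _ (hX.differentiableAt (by simp)).hasFDerivAt)
    exact (real_inner_comm _ _).trans (DFunLike.congr_fun h v)
  · have := hmax.trace_shapeOperator_nonpos hX
    rw [meanCurvature]
    linarith

end Surfaces

theorem proposition2p7 {M : Type*} [TopologicalSpace M] [T2Space M] [CompactSpace M] [Nonempty M]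
    [ChartedSpace Plane M] [IsManifold (𝓡 2) 2 M]
    (a : Space) (ha : a ≠ 0) (f : M → Space) :
    ¬ IsTranslatingSoliton a f := by
  rintro ⟨hf, hsol⟩
  have hpos : 0 < ‖a‖ := norm_pos_iff.mpr ha
  have hν : ‖‖a‖⁻¹ • a‖ = 1 := by
    rw [norm_smul, norm_inv, norm_norm, inv_mul_cancel₀ hpos.ne']
  have hcont : Continuous fun q => inner ℝ (‖a‖⁻¹ • a) (f q) :=
    continuous_const.inner hf.1.continuous
  obtain ⟨p, -, hp⟩ := isCompact_univ.exists_isMaxOn Set.univ_nonempty hcont.continuousOn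
  obtain ⟨hN, hH⟩ := hf.isUnitNormalAt_and_meanCurvature_nonpos hν fun q => hp (Set.mem_univ q)
  have h := hsol p _ hN
  have hin : inner ℝ (‖a‖⁻¹ • a) a = ‖a‖ := by
    rw [real_inner_smul_left, real_inner_self_eq_norm_sq]
    field_simp
  linarith
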